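/- **Setting.** For a probability distribution $F$ on $\mathbb{R}^d$ with continuous marginal distribution functions $F_1,\dots,F_d$ and $X=(X_1,\dots,X_d)\sim F$, say that $F$ has stable tail dependence function $\ell$ if $$\ell(x)=\lim_{t\downarrow 0}t^{-1}\Pr\bigl[1-F_1(X_1)\le t x_1\text{ or }\dots\text{ or }1-F_d(X_d)\le t x_d\bigr]\qquad\text{for all }x\in[0,\infty)^d .$$ A $d$-variate stable tail dependence function is a function $\ell$ that arises in this way from some such $F$. For a function $h$ on $[0,\infty)^d$ and $1\le u<v\le d$, write $h_{uv}(s,t)=h(0,\dots,0,s,0,\dots,0,t,0,\dots,0)$, with $s$ in position $u$ and $t$ in position $v$. Let $p\le q\le d(d-1)/2$, let $\Theta\subset\mathbb{R}^p$, let $\{\ell(\cdot;\theta):\theta\in\Theta\}$ be a family of $d$-variate stable tail dependence functions, and let $\pi(1),\dots,\pi(q)$ be distinct pairs $(u,v)$ with $1\le u<v\le d$. Define $\psi:\Theta\to\mathbb{R}^q$ by $$\psi(\theta)=\Bigl(\int_{[0,1]^2}\ell_{\pi(m)}(s,t;\theta)\,ds\,dt\Bigr)_{m=1}^q .$$ Given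 a sample $X_1,\dots,X_n$ in $\mathbb{R}^d$ and $k\in\{1,\dots,n\}$, let $R_{ij}^n=\#\{i'\le n: X_{i'j}\le X_{ij}\}$ be the rank of $X_{ij}$ among $X_{1j},\dots,X_{nj}$, and let $$\widehat\ell_{n,k}(x)=\frac1k\sum_{i=1}^n\mathbf 1\Bigl\{R_{i1}^n>n+\tfrac12-kx_1\text{ or }\dots\text{ or }R_{id}^n>n+\tfrac12-kx_d\Bigr\},$$ $$L_{n,k}(\theta)=\Bigl(\int_{[0,1]^2}\bigl\{\widehat\ell_{n,k,\pi(m)}(s,t)-\ell_{\pi(m)}(s,t;\theta)\bigr\}\,ds\,dt\Bigr)_{m=1}^q .$$ For a random $q\times q$ matrix $\widehat\Omega_n$, almost surely symmetric and positive definite, let $$f_{n,k,\widehat\Omega_n}(\theta)=L_{n,k}(\theta)^T\,\widehat\Omega_n\,L_{n,k}(\theta),\qquad\theta\in\Theta .$$ **Theorem 3.1 (Existence, uniqueness and consistency).** Suppose that $\psi$ is a homeomorphism from $\Theta$ onto $\psi(\Theta)$. Let $F$ be a distribution on $\mathbb{R}^d$ with continuous margins and with stable tail dependence function $\ell(\cdot;\theta_0)$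 for some interior point $\theta_0$ of $\Theta$, and let $X_1,X_2,\dots$ be independent random vectors with distribution $F$. Let $k=k_n\in\{1,\dots,n\}$ satisfy $k_n\to\infty$ and $k_n/n\to0$ as $n\to\infty$. Assume also that - (C1) $\psi$ is twice continuously differentiable on a neighbourhood of $\theta_0$ and its derivative $\dot\psi(\theta_0)\in\mathbb{R}^{q\times p}$ has full rank $p$; - (C2) there is a symmetric positive definite matrix $\Omega\in\mathbb{R}^{q\times q}$ such that $\widehat\Omega_n\to\Omega$ in probability, entrywise, as $n\to\infty$. Then, with probability tending to one as $n\to\infty$, the function $f_{n,k_n,\widehat\Omega_n}$ (based on $X_1,\dots,X_n$) has exactly one minimizer over $\Theta$. Moreover, if $\widehat\theta_n$ denotes this minimizer wherever it exists and is unique, with arbitrary values elsewhere, then $\widehat\theta_n\to\theta_0$ in probability as $n\to\infty$. -/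

import Mathlib

open MeasureTheory ProbabilityTheory Filter Topology
open scoped Matrix

noncomputable section

namespace PairwiseTail

/-- The `j`-th marginal distribution function `F_j` of a probability measure `P` on `ℝ^d`. -/
def marginCDF {d : ℕ} (P : Measure (Fin d → ℝ)) (j : Fin d) (y : ℝ) : ℝ :=
  cdf (P.map (fun x => x j)) y

/-- All margins of `P` are continuous. -/
def HasContinuousMargins {d : ℕ} (P : Measure (Fin d → ℝ)) : Prop :=
  ∀ j, Continuous (marginCDF P j)

/-- `P` has stable tail dependence function `ℓ`: for every `x ∈ [0,∞)^d`,
`ℓ(x) = lim_{t ↓ 0} t⁻¹ P[1 - F_1(X_1) ≤ t x_1 or … or 1 - F_d(X_d) ≤ t x_d]`.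
Only the values of `ℓ` on `[0,∞)^d` matter. -/
def HasSTDF {d : ℕ} (P : Measure (Fin d → ℝ)) (ℓ : (Fin d → ℝ) → ℝ) : Prop :=
  ∀ x : Fin d → ℝ, (∀ j, 0 ≤ x j) →
    Tendsto (fun t : ℝ => t⁻¹ * P.real {y | ∃ j, 1 - marginCDF P j (y j) ≤ t * x j})
      (𝓝[>] 0) (𝓝 (ℓ x))

/-- `ℓ` is a `d`-variate stable tail dependence function, that is, the stable tail dependence
function of some probability distribution on `ℝ^d` with continuous margins. -/
def IsSTDF {d : ℕ} (ℓ : (Fin d → ℝ) → ℝ) : Prop :=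
  ∃ P : Measure (Fin d → ℝ), IsProbabilityMeasure P ∧ HasContinuousMargins P ∧ HasSTDF P ℓ

/-- The rank `R_{ij}` of `X_{ij}` among `X_{1j}, …, X_{nj}`. -/
def sampleRank {n d : ℕ} (X : Fin n → Fin d → ℝ) (i : Fin n) (j : Fin d) : ℕ :=
  (Finset.univ.filter (fun i' : Fin n => X i' j ≤ X i j)).card

/-- The empirical stable tail dependence function
`(1/k) ∑_i 1{R_{i1} > n + 1/2 - k x_1 or … or R_{id} > n + 1/2 - k x_d}`. -/
def empSTDF {n d : ℕ} (k : ℕ) (X : Fin n → Fin d → ℝ) (x : Fin d → ℝ) : ℝ :=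
  (1 / (k : ℝ)) *
    ∑ i : Fin n, if ∃ j, (sampleRank X i j : ℝ) > (n : ℝ) + 1 / 2 - (k : ℝ) * x j then 1 else 0

/-- The bivariate margin `(s, t) ↦ h(0,…,0,s,0,…,0,t,0,…,0)` of `h`, with `s` at the first and
`t` at the second index of the pair `uv` (of distinct indices). -/
def pairMargin {d : ℕ} (h : (Fin d → ℝ) → ℝ) (uv : Fin d × Fin d) (z : ℝ × ℝ) : ℝ :=
  h (Pi.single uv.1 z.1 + Pi.single uv.2 z.2)

/-- The unit square `[0,1]²`. -/
def unitSquare : Set (ℝ × ℝ) := Set.Icc (0 : ℝ) 1 ×ˢ Set.Icc (0 : ℝ) 1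

/-- `ψ(θ)`, the vector of the integrals over `[0,1]²` of the pairwise margins of `ℓ(·;θ)`. -/
def psi {p q d : ℕ} (ℓ : EuclideanSpace ℝ (Fin p) → (Fin d → ℝ) → ℝ)
    (π : Fin q → Fin d × Fin d) (θ : EuclideanSpace ℝ (Fin p)) : Fin q → ℝ :=
  fun m => ∫ z in unitSquare, pairMargin (ℓ θ) (π m) z

/-- The discrepancy vector `L_{n,k}(θ)` of a sample `X`. -/
def discrepancy {n p q d : ℕ} (k : ℕ) (X : Fin n → Fin d → ℝ)
    (ℓ : EuclideanSpace ℝ (Fin p) → (Fin d → ℝ) → ℝ)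
    (π : Fin q → Fin d × Fin d) (θ : EuclideanSpace ℝ (Fin p)) : Fin q → ℝ :=
  fun m => ∫ z in unitSquare, (pairMargin (empSTDF k X) (π m) z - pairMargin (ℓ θ) (π m) z)

/-- The objective function `L_{n,k}(θ)ᵀ W L_{n,k}(θ)` with weight matrix `W`. -/
def objective {n p q d : ℕ} (k : ℕ) (X : Fin n → Fin d → ℝ)
    (ℓ : EuclideanSpace ℝ (Fin p) → (Fin d → ℝ) → ℝ)
    (π : Fin q → Fin d × Fin d) (W : Matrix (Fin q) (Fin q) ℝ)
    (θ : EuclideanSpace ℝ (Fin p)) : ℝ :=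
  discrepancy k X ℓ π θ ⬝ᵥ (W *ᵥ discrepancy k X ℓ π θ)

/-- The (possibly empty) set of minimizers over `Θ` of the objective function. -/
def minimizers {n p q d : ℕ} (Θ : Set (EuclideanSpace ℝ (Fin p))) (k : ℕ)
    (X : Fin n → Fin d → ℝ) (ℓ : EuclideanSpace ℝ (Fin p) → (Fin d → ℝ) → ℝ)
    (π : Fin q → Fin d × Fin d) (W : Matrix (Fin q) (Fin q) ℝ) :
    Set (EuclideanSpace ℝ (Fin p)) :=
  {θ | θ ∈ Θ ∧ ∀ θ' ∈ Θ, objective k X ℓ π W θ ≤ objective k X ℓ π W θ'}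

/-- The events `E n` hold with probability tending to one. Written with complements, because the
measure of a set is its outer measure; this form is correct even if `E n` is not measurable. -/
def WithProbTendingToOne {Ω : Type*} [MeasurableSpace Ω] (μ : Measure Ω)
    (E : ℕ → Set Ω) : Prop :=
  Tendsto (fun n => μ (E n)ᶜ) atTop (𝓝 0)

end PairwiseTail

end

open PairwiseTail

namespace PairwiseTail

/-! The objective depends on the sample only through the vector `T` of integrals of the empirical
tail function: it equals `B (T - ψ θ) (T - ψ θ)`, where `B` is the form of the weight matrix. The
proof therefore splits into a limit theorem for `T` and a deterministic statement about weighted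
least squares.

Probabilistic half: `T` tends to `ψ θ₀` in probability. With the true margins in place of ranks, the
joint and marginal exceedance counts are normalized sums of independent indicators, and Chebyshev's
inequality gives their limits `ℓ x` and `x j` (`tendstoInMeasure_tail_count`). Almost surely there
are no ties, so the rank counts are known up to a bounded error, and rank and value exceedance sets
are nested in each coordinate. Hence passing to ranks costs no more than the marginal errors
(`abs_empSTDF_sub_card_le`). Monotonicity of the empirical function and the Lipschitz property of
`ℓ` upgrade pointwise convergence on a finite grid to uniform control on the unit square, hence to
the integrals.

Deterministic half (`exists_forall_existsUnique_leastSquares`): if `T` is close to `ψ θ₀` and `B` is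
uniformly coercive and bounded, the embedding property confines every competitor at least as good as
`θ₀` to a small ball. Compactness of the closed ball gives a minimizer, although `Θ` need not be
closed. Two minimizers coincide because the residual is too small for the curvature of `ψ` to offset
the quadratic growth given by injectivity of the derivative. Convergence of the weights supplies the
uniform bounds with probability tending to one. -/

/-! ### Uniform marginal tails and Lipschitz continuity of stable tail dependence functions -/

theorem noAtoms_of_continuous_cdf (ν : Measure ℝ) [IsProbabilityMeasure ν]
    (hν : Continuous (cdf ν)) : NullSingletonClass ν := by
  refine ⟨fun y => ?_⟩
  rw [← measure_cdf ν, StieltjesFunction.measure_singleton,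
    (monotone_cdf ν).continuousWithinAt_Iio_iff_leftLim_eq.mp hν.continuousWithinAt]
  simp

/-- Probability integral transform: if `Y ~ ν` has a continuous distribution function `F`, then
`1 - F(Y)` is uniformly distributed. -/
theorem measureReal_one_sub_cdf_le (ν : Measure ℝ) [IsProbabilityMeasure ν]
    (hν : Continuous (cdf ν)) {u : ℝ} (h0 : 0 ≤ u) (h1 : u ≤ 1) :
    ν.real {y | 1 - cdf ν y ≤ u} = u := by
  have exists_cdf_eq : ∀ c : ℝ, 0 < c → c < 1 → ∃ y, cdf ν y = c := by
    intro c hc0 hc1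
    apply mem_range_of_exists_le_of_exists_ge hν
    · exact ((tendsto_cdf_atBot ν).eventually (ge_mem_nhds hc0)).exists
    · exact ((tendsto_cdf_atTop ν).eventually (le_mem_nhds hc1)).exists
  have real_Ioi : ∀ y, ν.real (Set.Ioi y) = 1 - cdf ν y := by
    intro y
    rw [cdf_eq_real, ← Set.compl_Iic, probReal_compl_eq_one_sub measurableSet_Iic]
  apply le_antisymm
  · rcases h1.eq_or_lt with rfl | h1
    · exact measureReal_le_one
    refine le_of_forall_pos_le_add fun ε hε => ?_
    rcases lt_or_ge (u + ε) 1 with h | h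
    · obtain ⟨y, hy⟩ := exists_cdf_eq (1 - (u + ε)) (by linarith) (by linarith)
      calc ν.real {z | 1 - cdf ν z ≤ u} ≤ ν.real (Set.Ioi y) := by
            refine measureReal_mono fun z hz => ?_
            by_contra hzy
            have := monotone_cdf ν (not_lt.mp hzy)
            simp only [Set.mem_ofPred_eq] at hz
            linarith
        _ = u + ε := by rw [real_Ioi, hy]; ring
    · exact measureReal_le_one.trans h
  · rcases h0.eq_or_lt with rfl | h0
    · exact measureReal_nonneg
    rcases h1.eq_or_lt with rfl | h1
    · have : {y | 1 - cdf ν y ≤ 1} = Set.univ :=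
        Set.eq_univ_of_forall fun y => sub_le_self 1 (cdf_nonneg ν y)
      rw [this, probReal_univ]
    obtain ⟨y, hy⟩ := exists_cdf_eq (1 - u) (by linarith) (by linarith)
    calc u = ν.real (Set.Ioi y) := by rw [real_Ioi, hy]; ring
      _ ≤ _ := by
        refine measureReal_mono fun z hz => ?_
        have := monotone_cdf ν (le_of_lt (Set.mem_Ioi.mp hz))
        simp only [Set.mem_ofPred_eq]
        linarith

variable {d : ℕ}

theorem isProbabilityMeasure_margin (P : Measure (Fin d → ℝ)) [IsProbabilityMeasure P] (j : Fin d) :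
    IsProbabilityMeasure (P.map (fun x => x j)) :=
  Measure.isProbabilityMeasure_map (measurable_pi_apply j).aemeasurable

theorem monotone_marginCDF (P : Measure (Fin d → ℝ)) (j : Fin d) : Monotone (marginCDF P j) :=
  monotone_cdf _

theorem measurableSet_margin_tail (P : Measure (Fin d → ℝ)) (j : Fin d) (u : ℝ) :
    MeasurableSet {y : Fin d → ℝ | 1 - marginCDF P j (y j) ≤ u} :=
  measurableSet_le
    (measurable_const.sub ((monotone_marginCDF P j).measurable.comp (measurable_pi_apply j)))
    measurable_const

theorem measureReal_margin_tail {P : Measure (Fin d → ℝ)} [IsProbabilityMeasure P]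
    (hP : HasContinuousMargins P) (j : Fin d) {u : ℝ} (h0 : 0 ≤ u) (h1 : u ≤ 1) :
    P.real {y | 1 - marginCDF P j (y j) ≤ u} = u := by
  have := isProbabilityMeasure_margin P j
  have h := measureReal_one_sub_cdf_le (P.map (fun x : Fin d → ℝ => x j)) (hP j) h0 h1
  rwa [map_measureReal_apply (measurable_pi_apply j)] at h
  exact measurableSet_le (measurable_const.sub (monotone_cdf _).measurable) measurable_const

theorem measurableSet_joint_tail (P : Measure (Fin d → ℝ)) (u : Fin d → ℝ) :
    MeasurableSet {y : Fin d → ℝ | ∃ j, 1 - marginCDF P j (y j) ≤ u j} := by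
  rw [Set.ofPred_exists]
  exact MeasurableSet.iUnion fun j => measurableSet_margin_tail P j (u j)

theorem eventually_mul_le_one (c : ℝ) : ∀ᶠ t : ℝ in 𝓝[>] 0, t * c ≤ 1 := by
  have : Tendsto (fun t : ℝ => t * c) (𝓝 0) (𝓝 (0 * c)) := tendsto_id.mul_const c
  rw [zero_mul] at this
  exact (this.mono_left nhdsWithin_le_nhds).eventually (ge_mem_nhds one_pos)

/-- A point in the event for `x` but not in that for `y` lies, for some `j`, in the difference of
the two marginal tail events. Uniformity of the margins bounds the probability of that difference by
`t * |x j - y j|`; divide by `t` and let `t ↓ 0`. -/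
theorem HasSTDF.le_add_sum {P : Measure (Fin d → ℝ)} [IsProbabilityMeasure P]
    {ℓ : (Fin d → ℝ) → ℝ} (hP : HasContinuousMargins P) (hℓ : HasSTDF P ℓ) {x y : Fin d → ℝ}
    (hx : ∀ j, 0 ≤ x j) (hy : ∀ j, 0 ≤ y j) : ℓ x ≤ ℓ y + ∑ j, |x j - y j| := by
  refine le_of_tendsto_of_tendsto (hℓ x hx) ((hℓ y hy).add_const _) ?_
  have h1 : ∀ᶠ t : ℝ in 𝓝[>] 0, ∀ j, t * x j ≤ 1 :=
    eventually_all.mpr fun j => eventually_mul_le_one _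
  have h2 : ∀ᶠ t : ℝ in 𝓝[>] 0, ∀ j, t * y j ≤ 1 :=
    eventually_all.mpr fun j => eventually_mul_le_one _
  filter_upwards [h1, h2, self_mem_nhdsWithin] with t ht1 ht2 ht
  have ht : 0 < t := ht
  let A : (Fin d → ℝ) → Fin d → Set (Fin d → ℝ) := fun x j =>
    {z | 1 - marginCDF P j (z j) ≤ t * x j}
  have hA_mono : ∀ {a b : Fin d → ℝ} {j}, b j ≤ a j → A b j ⊆ A a j :=
    fun h z hz => le_trans (show _ ≤ _ from hz) (mul_le_mul_of_nonneg_left h ht.le)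
  have hA : ∀ j, P.real (A x j \ A y j) ≤ t * |x j - y j| := by
    intro j
    rcases le_total (x j) (y j) with h | h
    · have : A x j \ A y j = ∅ := by
        rw [Set.sdiff_eq_empty]
        exact hA_mono h
      rw [this, measureReal_empty]
      positivity
    · rw [measureReal_sdiff (hA_mono h) (measurableSet_margin_tail P j _), measureReal_margin_tail hP j (by have := hx j; positivity)
        (ht1 j), measureReal_margin_tail hP j (by have := hy j; positivity) (ht2 j), ← mul_sub,
        abs_of_nonneg (sub_nonneg.mpr h)]
  have hle : P.real {z | ∃ j, 1 - marginCDF P j (z j) ≤ t * x j} ≤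
      P.real {z | ∃ j, 1 - marginCDF P j (z j) ≤ t * y j} + t * ∑ j, |x j - y j| := by
    calc _ ≤ P.real ({z | ∃ j, 1 - marginCDF P j (z j) ≤ t * y j} ∪ ⋃ j, A x j \ A y j) := by
          refine measureReal_mono ?_
          rintro z ⟨j, hj⟩
          by_cases hz : ∃ j, 1 - marginCDF P j (z j) ≤ t * y j
          · exact Or.inl hz
          · exact Or.inr (Set.mem_iUnion.mpr ⟨j, hj, fun h => hz ⟨j, h⟩⟩)
      _ ≤ P.real {z | ∃ j, 1 - marginCDF P j (z j) ≤ t * y j} + ∑ j, P.real (A x j \ A y j) :=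
          (measureReal_union_le _ _).trans (by gcongr; exact measureReal_iUnion_fintype_le _)
      _ ≤ _ := by
          rw [Finset.mul_sum]
          gcongr with j
          exact hA j
  calc _ ≤ t⁻¹ * (P.real {z | ∃ j, 1 - marginCDF P j (z j) ≤ t * y j} +
        t * ∑ j, |x j - y j|) := by gcongr
    _ = _ := by rw [mul_add, inv_mul_cancel_left₀ ht.ne']

theorem pairMargin_arg_nonneg (uv : Fin d × Fin d) {z : ℝ × ℝ} (hz : z ∈ unitSquare) (j : Fin d) :
    0 ≤ (Pi.single uv.1 z.1 + Pi.single uv.2 z.2 : Fin d → ℝ) j := by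
  obtain ⟨h1, h2⟩ := hz
  simp only [Pi.add_apply, Pi.single_apply]
  split_ifs <;> simp [h1.1, h2.1, add_nonneg]

theorem sum_abs_single_sub_single (u : Fin d) (a b : ℝ) :
    ∑ j, |(Pi.single u a : Fin d → ℝ) j - (Pi.single u b : Fin d → ℝ) j| = |a - b| := by
  rw [Finset.sum_eq_single u]
  · simp
  · intro j _ hj; simp [hj]
  · simp

theorem HasSTDF.pairMargin_le {P : Measure (Fin d → ℝ)} [IsProbabilityMeasure P]
    {ℓ : (Fin d → ℝ) → ℝ} (hP : HasContinuousMargins P) (hℓ : HasSTDF P ℓ) (uv : Fin d × Fin d)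
    {z w : ℝ × ℝ} (hz : z ∈ unitSquare) (hw : w ∈ unitSquare) :
    pairMargin ℓ uv z ≤ pairMargin ℓ uv w + (|z.1 - w.1| + |z.2 - w.2|) := by
  refine (hℓ.le_add_sum hP (pairMargin_arg_nonneg uv hz) (pairMargin_arg_nonneg uv hw)).trans ?_
  rw [pairMargin, ← sum_abs_single_sub_single uv.1 z.1 w.1,
    ← sum_abs_single_sub_single uv.2 z.2 w.2, ← Finset.sum_add_distrib]
  gcongr with j
  simp only [Pi.add_apply]
  rw [add_sub_add_comm]
  exact abs_add_le _ _

theorem isCompact_unitSquare : IsCompact unitSquare := isCompact_Icc.prod isCompact_Icc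

theorem volume_unitSquare : volume unitSquare = 1 := by
  rw [unitSquare, Measure.volume_eq_prod, Measure.prod_prod]
  simp

/-- Needed because the discrepancy integrates a difference, which splits into two integrals only
when both terms are integrable. -/
theorem IsSTDF.integrableOn_pairMargin {ℓ : (Fin d → ℝ) → ℝ} (hℓ : IsSTDF ℓ)
    (uv : Fin d × Fin d) : IntegrableOn (pairMargin ℓ uv) unitSquare := by
  obtain ⟨P, hPp, hP, hPℓ⟩ := hℓ
  refine ContinuousOn.integrableOn_compact isCompact_unitSquare ?_
  have : LipschitzOnWith 2 (pairMargin ℓ uv) unitSquare := by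
    refine LipschitzOnWith.of_le_add_mul 2 fun z hz w hw => ?_
    refine (hPℓ.pairMargin_le hP uv hz hw).trans ?_
    rw [Prod.dist_eq, ← Real.dist_eq, ← Real.dist_eq]
    have h1 := le_max_left (dist z.1 w.1) (dist z.2 w.2)
    have h2 := le_max_right (dist z.1 w.1) (dist z.2 w.2)
    push_cast
    linarith
  exact this.continuousOn

/-! ### Convergence in probability and a weak law for tail counts -/

section Probability

variable {Ω : Type*} [MeasurableSpace Ω] {μ : Measure Ω}

/-- If every one of the finitely many errors is at most `η`, with `η` times their number below `ε -
δ`, the deviation of `Y n` stays below `ε`; a union bound does the rest. It serves every later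
transfer of convergence. -/
theorem tendsto_measure_abs_sub_of_le_sum {ι : Type*} [Fintype ι] {Z : ι → ℕ → Ω → ℝ} {z : ι → ℝ}
    (hZ : ∀ a, TendstoInMeasure μ (Z a) atTop (fun _ => z a)) {Y : ℕ → Ω → ℝ} {y δ ε : ℝ}
    (hδ : δ < ε)
    (h : ∀ᶠ n in atTop, ∀ᵐ ω ∂μ, |Y n ω - y| ≤ ∑ a, |Z a n ω - z a| + δ) :
    Tendsto (fun n => μ {ω | ε ≤ |Y n ω - y|}) atTop (𝓝 0) := by
  obtain ⟨η, hη0, hη⟩ : ∃ η : ℝ, 0 < η ∧ Fintype.card ι * η < ε - δ := by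
    refine ⟨(ε - δ) / (Fintype.card ι + 1), div_pos (by linarith) (by positivity), ?_⟩
    rw [mul_div_assoc', div_lt_iff₀ (by positivity)]
    nlinarith
  have hsum : Tendsto (fun n => ∑ a, μ {ω | η ≤ |Z a n ω - z a|}) atTop (𝓝 0) := by
    rw [← Finset.sum_const_zero (s := (Finset.univ : Finset ι))]
    exact tendsto_finsetSum _ fun a _ => tendstoInMeasure_iff_norm.mp (hZ a) η hη0
  refine tendsto_of_tendsto_of_tendsto_of_le_of_le' tendsto_const_nhds hsum
    (Eventually.of_forall fun _ => zero_le) ?_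
  filter_upwards [h] with n hn
  calc μ {ω | ε ≤ |Y n ω - y|} ≤ μ (⋃ a, {ω | η ≤ |Z a n ω - z a|}) := by
        refine measure_mono_ae ?_
        filter_upwards [hn] with ω hω hε
        have hε : ε ≤ |Y n ω - y| := hε
        by_contra hcon
        have hlt : ∀ a, |Z a n ω - z a| ≤ η := fun a => by
          by_contra ha
          exact hcon (Set.mem_iUnion.mpr ⟨a, (not_le.mp ha).le⟩)
        have := Finset.sum_le_sum fun a (_ : a ∈ Finset.univ) => hlt a
        rw [Finset.sum_const, Finset.card_univ, nsmul_eq_mul] at this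
        linarith
    _ ≤ _ := measure_iUnion_fintype_le _ _

theorem tendstoInMeasure_const_of_abs_sub {Y : ℕ → Ω → ℝ} {y : ℝ}
    (h : ∀ ε : ℝ, 0 < ε → Tendsto (fun n => μ {ω | ε ≤ |Y n ω - y|}) atTop (𝓝 0)) :
    TendstoInMeasure μ Y atTop (fun _ => y) :=
  tendstoInMeasure_iff_norm.mpr h

/-- Weak law of large numbers for a triangular array of indicators with `n P(S n) = O(k n)`. -/
theorem tendstoInMeasure_tail_count [IsProbabilityMeasure μ] {E : Type*} [MeasurableSpace E]
    {P : Measure E} [IsProbabilityMeasure P] {X : ℕ → Ω → E} (hX_meas : ∀ i, Measurable (X i))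
    (hX_indep : iIndepFun X μ) (hX_law : ∀ i, μ.map (X i) = P) {k : ℕ → ℕ}
    (hk_top : Tendsto k atTop atTop) {S : ℕ → Set E} (hS : ∀ n, MeasurableSet (S n)) {c : ℝ}
    (hc : Tendsto (fun n : ℕ => ((k n : ℝ) / n)⁻¹ * P.real (S n)) atTop (𝓝 c)) :
    TendstoInMeasure μ
      (fun n ω => (1 / (k n : ℝ)) * ∑ i : Fin n, (S n).indicator (1 : E → ℝ) (X i ω))
      atTop (fun _ => c) := by
  let Y : ∀ n : ℕ, Fin n → Ω → ℝ := fun n i ω => (S n).indicator (1 : E → ℝ) (X i ω)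
  let m : ℕ → ℝ := fun n => ((k n : ℝ) / n)⁻¹ * P.real (S n)
  have hY_eq : ∀ n i, Y n i = (X i ⁻¹' S n).indicator 1 := fun n i => rfl
  have hS' : ∀ n i, MeasurableSet (X i ⁻¹' S n) := fun n i => hX_meas i (hS n)
  have hY_memLp : ∀ n i, MemLp (Y n i) 2 μ := fun n i =>
    (memLp_const (1 : ℝ)).indicator (hS' n i)
  have hY_int : ∀ n i, ∫ ω, Y n i ω ∂μ = P.real (S n) := fun n i => by
    rw [hY_eq, integral_indicator_one (hS' n i), ← hX_law i,
      map_measureReal_apply (hX_meas i) (hS n)]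
  -- An indicator equals its square, so its second moment is its mean.
  have hY_var : ∀ n i, Var[Y n i; μ] ≤ P.real (S n) := fun n i => by
    refine (variance_le_expectation_sq (hY_memLp n i).aestronglyMeasurable).trans_eq ?_
    rw [← hY_int n i]
    congr 1 with ω
    by_cases hmem : X i ω ∈ S n <;> simp [Y, hmem]
  have hY_indep : ∀ n, Set.Pairwise (Finset.univ : Finset (Fin n)) fun i j =>
      Y n i ⟂ᵢ[μ] Y n j := fun n i _ j _ hij =>
    ((hX_indep.indepFun (fun h => hij (Fin.ext h))).comp
      (measurable_one.indicator (hS n)) (measurable_one.indicator (hS n)))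
  let Z : ℕ → Ω → ℝ := fun n ω => (1 / (k n : ℝ)) * (∑ i, Y n i) ω
  have hZ_memLp : ∀ n, MemLp (Z n) 2 μ := fun n =>
    (memLp_finsetSum' _ fun i _ => hY_memLp n i).const_mul _
  have hZ_int : ∀ n, ∫ ω, Z n ω ∂μ = m n := fun n => by
    simp only [Z, Finset.sum_apply]
    rw [integral_const_mul, integral_finsetSum _ fun i _ =>
      (hY_memLp n i).integrable one_le_two]
    simp only [hY_int, Finset.sum_const, Finset.card_univ, Fintype.card_fin, nsmul_eq_mul, m,
      inv_div]
    ring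
  -- Pairwise independence gives at most `n * P.real (S n) / k n ^ 2`, which is `m n / k n`. Since
  -- `m n` converges and `k n → ∞`, it vanishes.
  have hZ_var : ∀ n, Var[Z n; μ] ≤ (1 / (k n : ℝ)) * m n := fun n => by
    simp only [Z]
    rw [variance_const_mul, IndepFun.variance_sum (fun i _ => hY_memLp n i) (hY_indep n)]
    calc _ ≤ (1 / (k n : ℝ)) ^ 2 * ∑ i : Fin n, P.real (S n) := by
          gcongr with i
          exact hY_var n i
      _ = _ := by
          simp only [Finset.sum_const, Finset.card_univ, Fintype.card_fin, nsmul_eq_mul, m, inv_div]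
          ring
  have hdev : TendstoInMeasure μ (fun n ω => Z n ω - m n) atTop (fun _ => 0) := by
    refine tendstoInMeasure_const_of_abs_sub fun ε hε => ?_
    have hlim : Tendsto (fun n => ENNReal.ofReal ((1 / (k n : ℝ)) * m n / ε ^ 2)) atTop (𝓝 0) := by
      have h1 : Tendsto (fun n => 1 / (k n : ℝ)) atTop (𝓝 0) :=
        tendsto_one_div_atTop_nhds_zero_nat.comp hk_top
      have := ENNReal.tendsto_ofReal ((h1.mul hc).div_const (ε ^ 2))
      rwa [zero_mul, zero_div, ENNReal.ofReal_zero] at this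
    refine tendsto_of_tendsto_of_tendsto_of_le_of_le tendsto_const_nhds hlim
      (fun _ => zero_le) fun n => ?_
    have := meas_ge_le_variance_div_sq (hZ_memLp n) hε
    rw [hZ_int] at this
    simp only [sub_zero]
    refine this.trans (ENNReal.ofReal_le_ofReal ?_)
    gcongr
    exact hZ_var n
  refine tendstoInMeasure_const_of_abs_sub fun ε hε => ?_
  refine tendsto_measure_abs_sub_of_le_sum (ι := Unit) (fun _ => hdev) (half_lt_self hε) ?_
  filter_upwards [Metric.tendsto_nhds.mp hc (ε / 2) (half_pos hε)] with n hn
  refine Eventually.of_forall fun ω => ?_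
  have hn : |m n - c| < ε / 2 := hn
  have hZ : (1 / (k n : ℝ)) * ∑ i : Fin n, (S n).indicator (1 : E → ℝ) (X i ω) = Z n ω := by
    simp only [Z, Finset.sum_apply, Y]
  rw [hZ]
  simp only [Finset.univ_unique, Finset.sum_const, Finset.card_singleton, one_smul, sub_zero]
  have := abs_sub_le (Z n ω) (m n) c
  linarith

end Probability

/-! ### Counting joint exceedances through marginal ones -/

open Finset in
-- The difference of the two unions is covered by the differences `A j \ B j`. Nestedness makes the
-- size of each either zero or exactly the difference of the cardinalities; without it, equal counts
-- could hide large symmetric differences.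
theorem abs_card_exists_sub_card_exists_le {ι κ : Type*} [Fintype ι] [Fintype κ] [DecidableEq ι]
    (A B : κ → ι → Prop) [∀ j, DecidablePred (A j)] [∀ j, DecidablePred (B j)]
    [DecidablePred fun i => ∃ j, A j i] [DecidablePred fun i => ∃ j, B j i]
    (hAB : ∀ j, (∀ i, A j i → B j i) ∨ (∀ i, B j i → A j i)) :
    |(#{i | ∃ j, A j i} : ℝ) - #{i | ∃ j, B j i}| ≤ ∑ j, |(#{i | A j i} : ℝ) - #{i | B j i}| := by
  have key : ∀ (A B : κ → ι → Prop) [∀ j, DecidablePred (A j)] [∀ j, DecidablePred (B j)]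
    [DecidablePred fun i => ∃ j, A j i] [DecidablePred fun i => ∃ j, B j i],
      (∀ j, (∀ i, A j i → B j i) ∨ (∀ i, B j i → A j i)) →
      (#{i | ∃ j, A j i} : ℝ) ≤ #{i | ∃ j, B j i} + ∑ j, |(#{i | A j i} : ℝ) - #{i | B j i}| := by
    intro A B _ _ _ _ hAB
    have hcard : ∀ j, (#{i | A j i ∧ ¬ B j i} : ℝ) ≤ |(#{i | A j i} : ℝ) - #{i | B j i}| := by
      intro j
      rcases hAB j with h | h
      · have : #{i | A j i ∧ ¬ B j i} = 0 := by
          rw [card_eq_zero, filter_eq_empty_iff]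
          exact fun i _ hi => hi.2 (h i hi.1)
        rw [this]
        simp
      · have : #{i | A j i} = #{i | A j i ∧ ¬ B j i} + #{i | B j i} := by
          rw [← card_union_of_disjoint]
          · congr 1
            ext i
            have := h i
            simp only [mem_filter, mem_union, mem_univ, true_and]
            tauto
          · rw [disjoint_filter]
            exact fun i _ hi => hi.2
        rw [this]
        push_cast
        rw [add_sub_cancel_right]
        exact le_abs_self _
    have hle : #{i | ∃ j, A j i} ≤ #{i | ∃ j, B j i} + ∑ j, #{i | A j i ∧ ¬ B j i} := by
      refine (card_le_card (t := ({i | ∃ j, B j i} : Finset ι) ∪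
        univ.biUnion fun j => ({i | A j i ∧ ¬ B j i} : Finset ι)) ?_).trans
        ((card_union_le _ _).trans (Nat.add_le_add_left card_biUnion_le _))
      intro i hi
      simp only [mem_filter, mem_univ, true_and, mem_union, mem_biUnion] at hi ⊢
      obtain ⟨j, hj⟩ := hi
      by_cases hB : ∃ j, B j i
      · exact Or.inl hB
      · exact Or.inr ⟨j, hj, fun h => hB ⟨j, h⟩⟩
    calc (#{i | ∃ j, A j i} : ℝ) ≤ #{i | ∃ j, B j i} + ∑ j, (#{i | A j i ∧ ¬ B j i} : ℝ) := by
          exact_mod_cast hle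
      _ ≤ _ := by
          gcongr with j
          exact hcard j
  rw [abs_le]
  have h1 := key A B hAB
  have h2 := key B A fun j => (hAB j).symm
  simp only [abs_sub_comm] at h1 h2 ⊢
  constructor <;> linarith

/-! ### Ranks and the empirical tail dependence function -/

section Rank

variable {n d : ℕ} {X : Fin n → Fin d → ℝ}

theorem sampleRank_mono {i i' : Fin n} {j : Fin d} (h : X i j ≤ X i' j) :
    sampleRank X i j ≤ sampleRank X i' j :=
  Finset.card_le_card fun a ha => by
    simp only [Finset.mem_filter, Finset.mem_univ, true_and] at ha ⊢
    exact ha.trans h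

theorem sampleRank_strictMono {i i' : Fin n} {j : Fin d} (h : X i j < X i' j) :
    sampleRank X i j < sampleRank X i' j := by
  refine Finset.card_lt_card ?_
  rw [Finset.ssubset_iff_of_subset]
  · exact ⟨i', by simp, by simpa using h⟩
  · intro a ha
    simp only [Finset.mem_filter, Finset.mem_univ, true_and] at ha ⊢
    exact ha.trans h.le

theorem sampleRank_mem_Icc (X : Fin n → Fin d → ℝ) (i : Fin n) (j : Fin d) :
    sampleRank X i j ∈ Finset.Icc 1 n := by
  rw [Finset.mem_Icc]
  constructor
  · exact Finset.card_pos.mpr ⟨i, by simp⟩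
  · exact (Finset.card_le_univ _).trans_eq (Fintype.card_fin n)

theorem sampleRank_injective {j : Fin d} (hX : Function.Injective fun i => X i j) :
    Function.Injective fun i => sampleRank X i j := by
  intro i i' h
  by_contra hne
  rcases lt_or_gt_of_ne (fun h' => hne (hX h')) with h' | h'
  · exact (sampleRank_strictMono h').ne h
  · exact (sampleRank_strictMono h').ne' h

theorem image_sampleRank {j : Fin d} (hX : Function.Injective fun i => X i j) :
    Finset.univ.image (fun i => sampleRank X i j) = Finset.Icc 1 n := by
  refine Finset.eq_of_subset_of_card_le ?_ ?_
  · intro r hr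
    obtain ⟨i, -, rfl⟩ := Finset.mem_image.mp hr
    exact sampleRank_mem_Icc X i j
  · rw [Finset.card_image_of_injective _ (sampleRank_injective hX)]
    simp

open Finset in
-- Without ties the ranks are a permutation of `1, …, n`, so the count is that of the integers in
-- `(n + 1/2 - a, n]`.
theorem abs_card_sampleRank_gt_sub_le {j : Fin d} (hX : Function.Injective fun i => X i j) {a : ℝ}
    (ha0 : 0 ≤ a) (han : a ≤ n) :
    |(#{i | (sampleRank X i j : ℝ) > (n : ℝ) + 1 / 2 - a} : ℝ) - a| ≤ 1 := by
  have hc0 : 0 ≤ (n : ℝ) + 1 / 2 - a := by linarith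
  have hcard : #{i | (sampleRank X i j : ℝ) > (n : ℝ) + 1 / 2 - a} =
      #(Ioc ⌊(n : ℝ) + 1 / 2 - a⌋₊ n) := by
    rw [← card_image_of_injective _ (sampleRank_injective hX)]
    congr 1
    ext r
    simp only [mem_image, mem_filter, mem_univ, true_and, mem_Ioc, Nat.floor_lt hc0]
    constructor
    · rintro ⟨i, hi, rfl⟩
      exact ⟨hi, (mem_Icc.mp (sampleRank_mem_Icc X i j)).2⟩
    · rintro ⟨h1, h2⟩
      have hr : r ∈ univ.image (fun i => sampleRank X i j) := by
        rw [image_sampleRank hX, mem_Icc]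
        exact ⟨Nat.cast_pos.mp (hc0.trans_lt h1), h2⟩
      obtain ⟨i, -, rfl⟩ := mem_image.mp hr
      exact ⟨i, h1, rfl⟩
  have hfloor : ⌊(n : ℝ) + 1 / 2 - a⌋₊ ≤ n := by
    rw [← Nat.lt_succ_iff, Nat.floor_lt hc0]
    push_cast
    linarith
  rw [hcard, Nat.card_Ioc, Nat.cast_sub hfloor, abs_le]
  have h1 := Nat.floor_le hc0
  have h2 := Nat.lt_floor_add_one ((n : ℝ) + 1 / 2 - a)
  constructor <;> linarith

open Finset in
/-- Replacing ranks by the values of monotone transforms changes the number of joint exceedances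
by no more than it changes the numbers of marginal exceedances. -/
theorem abs_empSTDF_sub_card_le {k : ℕ} (hk : 1 ≤ k) (G : Fin d → ℝ → ℝ) (hG : ∀ j, Monotone (G j))
    (hX : ∀ j, Function.Injective fun i => X i j) {x : Fin d → ℝ} (hx : ∀ j, 0 ≤ x j)
    (hxn : ∀ j, k * x j ≤ n) (u : Fin d → ℝ) :
    |empSTDF k X x - 1 / (k : ℝ) * #{i | ∃ j, 1 - G j (X i j) ≤ u j}| ≤
      ∑ j, |1 / (k : ℝ) * #{i | 1 - G j (X i j) ≤ u j} - x j| + d / (k : ℝ) := by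
  have hk0 : (0 : ℝ) < k := by exact_mod_cast hk
  -- For each `j`, both exceedance sets are closed upwards in the order of the `j`-th coordinates,
  -- so one contains the other.
  have h := abs_card_exists_sub_card_exists_le
    (fun (j : Fin d) (i : Fin n) => (sampleRank X i j : ℝ) > (n : ℝ) + 1 / 2 - k * x j)
    (fun (j : Fin d) (i : Fin n) => 1 - G j (X i j) ≤ u j) (fun j => by
      by_contra! hcon
      obtain ⟨⟨i, hi1, hi2⟩, i', hi1', hi2'⟩ := hcon
      rcases le_total (X i j) (X i' j) with h | h
      · have : (sampleRank X i j : ℝ) ≤ sampleRank X i' j := by exact_mod_cast sampleRank_mono h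
        linarith
      · have := hG j h
        linarith)
  rw [empSTDF, Finset.sum_boole, ← mul_sub, abs_mul, abs_of_pos (one_div_pos.mpr hk0)]
  have hd : (d : ℝ) / k = ∑ _j : Fin d, 1 / (k : ℝ) := by simp [div_eq_mul_inv]
  rw [hd, ← Finset.sum_add_distrib]
  refine (mul_le_mul_of_nonneg_left h (one_div_pos.mpr hk0).le).trans ?_
  rw [Finset.mul_sum]
  gcongr with j
  -- The rank count is within one of `k * x j`, which serves as the intermediate value; summing
  -- these unit errors gives the term `d / k`.
  have h1 := abs_card_sampleRank_gt_sub_le (hX j) (mul_nonneg hk0.le (hx j)) (hxn j)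
  set a : ℝ := (#{i | (sampleRank X i j : ℝ) > (n : ℝ) + 1 / 2 - k * x j} : ℝ)
  set b : ℝ := (#{i | 1 - G j (X i j) ≤ u j} : ℝ)
  have h2 : |1 / (k : ℝ) * b - x j| = 1 / (k : ℝ) * |b - k * x j| := by
    rw [← abs_of_pos (one_div_pos.mpr hk0), ← abs_mul, abs_of_pos (one_div_pos.mpr hk0)]
    congr 1
    field_simp
  rw [h2, ← mul_add_one]
  gcongr
  rw [abs_sub_comm b]
  linarith [abs_sub_le a (k * x j) b]

theorem empSTDF_mono (k : ℕ) (X : Fin n → Fin d → ℝ) {x y : Fin d → ℝ} (h : x ≤ y) :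
    empSTDF k X x ≤ empSTDF k X y := by
  unfold empSTDF
  gcongr with i
  split_ifs with h1 h2
  · rfl
  · obtain ⟨j, hj⟩ := h1
    refine absurd ⟨j, ?_⟩ h2
    have := mul_le_mul_of_nonneg_left (h j) (Nat.cast_nonneg (α := ℝ) k)
    linarith
  · exact zero_le_one
  · rfl

theorem integrableOn_pairMargin_empSTDF (k : ℕ) (X : Fin n → Fin d → ℝ) (uv : Fin d × Fin d) :
    IntegrableOn (pairMargin (empSTDF k X) uv) unitSquare := by
  have hmeas : Measurable (pairMargin (empSTDF k X) uv) := by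
    unfold pairMargin empSTDF
    refine measurable_const.mul (Finset.measurable_sum _ fun i _ => ?_)
    refine Measurable.ite ?_ measurable_const measurable_const
    rw [Set.ofPred_exists]
    refine MeasurableSet.iUnion fun j => measurableSet_lt ?_ measurable_const
    refine measurable_const.sub (measurable_const.mul ?_)
    simp only [Pi.add_apply, Pi.single_apply]
    refine Measurable.add ?_ ?_
    · split_ifs
      exacts [measurable_fst, measurable_const]
    · split_ifs
      exacts [measurable_snd, measurable_const]
  refine Measure.integrableOn_of_bounded (M := 1 / (k : ℝ) * n)
    (by rw [volume_unitSquare]; exact ENNReal.one_ne_top) hmeas.aestronglyMeasurable ?_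
  refine Eventually.of_forall fun z => ?_
  unfold pairMargin empSTDF
  rw [Finset.sum_boole, norm_mul, Real.norm_of_nonneg (by positivity),
    Real.norm_of_nonneg (by positivity)]
  gcongr
  exact_mod_cast (Finset.card_le_univ _).trans_eq (Fintype.card_fin n)

end Rank

/-! ### Consistency of the empirical tail dependence function and its integrals -/

section EmpiricalConvergence

variable {d : ℕ} {Ω : Type*} [MeasurableSpace Ω] {μ : Measure Ω} [IsProbabilityMeasure μ]
  {P : Measure (Fin d → ℝ)} [IsProbabilityMeasure P] {X : ℕ → Ω → (Fin d → ℝ)}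

/-- Two independent observations of one coordinate have an atomless product law, which gives the
diagonal measure zero by Fubini; there are only countably many pairs. -/
theorem ae_injective_coord (hP : HasContinuousMargins P) (hX_meas : ∀ i, Measurable (X i))
    (hX_indep : iIndepFun X μ) (hX_law : ∀ i, μ.map (X i) = P) :
    ∀ᵐ ω ∂μ, ∀ j, Function.Injective fun i => X i ω j := by
  have key : ∀ j i i', i ≠ i' → ∀ᵐ ω ∂μ, X i ω j ≠ X i' ω j := by
    intro j i i' hne
    have hm : ∀ i, Measurable fun ω => X i ω j := fun i =>
      (measurable_pi_apply j).comp (hX_meas i)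
    have hlaw : ∀ i, μ.map (fun ω => X i ω j) = P.map (fun x => x j) := fun i => by
      rw [← hX_law i, Measure.map_map (measurable_pi_apply j) (hX_meas i)]
      rfl
    have hind : (fun ω => X i ω j) ⟂ᵢ[μ] (fun ω => X i' ω j) :=
      (hX_indep.indepFun hne).comp (measurable_pi_apply j) (measurable_pi_apply j)
    have hprod := (indepFun_iff_map_prod_eq_prod_map_map (hm i).aemeasurable
      (hm i').aemeasurable).mp hind
    rw [hlaw, hlaw] at hprod
    have := isProbabilityMeasure_margin P j
    have := noAtoms_of_continuous_cdf (P.map (fun x : Fin d → ℝ => x j)) (hP j)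
    have hdiag : MeasurableSet {z : ℝ × ℝ | z.1 = z.2} :=
      measurableSet_eq_fun measurable_fst measurable_snd
    have hzero : μ.map (fun ω => (X i ω j, X i' ω j)) {z : ℝ × ℝ | z.1 = z.2} = 0 := by
      rw [hprod, Measure.prod_apply hdiag]
      refine lintegral_eq_zero_of_ae_eq_zero (Eventually.of_forall fun y => ?_)
      have : Prod.mk y ⁻¹' {z : ℝ × ℝ | z.1 = z.2} = {y} := by
        ext w; exact eq_comm
      beta_reduce
      rw [this]
      exact measure_singleton y
    rw [Measure.map_apply ((hm i).prodMk (hm i')) hdiag] at hzero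
    rw [ae_iff]
    simpa using hzero
  have : ∀ᵐ ω ∂μ, ∀ j i i', i ≠ i' → X i ω j ≠ X i' ω j := by
    simp only [ae_all_iff]
    exact key
  filter_upwards [this] with ω hω j i i' h
  by_contra hne
  exact hω j i i' hne h

theorem sum_indicator_one_eq_card {n : ℕ} {E : Type*} (p : E → Prop) [DecidablePred p]
    (Y : Fin n → E) :
    ∑ i, {y | p y}.indicator (1 : E → ℝ) (Y i) = (Finset.univ.filter fun i => p (Y i)).card := by
  classical
  rw [← Finset.sum_boole]
  refine Finset.sum_congr rfl fun i _ => ?_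
  by_cases h : p (Y i) <;> simp [h]

/-- The law for tail counts applies at level `t = k n / n` to the joint event and to each margin;
the marginal limits `x j` make the cost of using ranks vanish. -/
theorem tendstoInMeasure_empSTDF (hP : HasContinuousMargins P) {ℓ : (Fin d → ℝ) → ℝ}
    (hPℓ : HasSTDF P ℓ) (hX_meas : ∀ i, Measurable (X i))
    (hX_indep : iIndepFun X μ) (hX_law : ∀ i, μ.map (X i) = P) {k : ℕ → ℕ}
    (hk : ∀ n, 1 ≤ n → 1 ≤ k n ∧ k n ≤ n)
    (hk_top : Tendsto k atTop atTop)
    (hk_zero : Tendsto (fun n => (k n : ℝ) / (n : ℝ)) atTop (𝓝 0))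
    {x : Fin d → ℝ} (hx : ∀ j, 0 ≤ x j) :
    TendstoInMeasure μ (fun n ω => empSTDF (k n) (fun i : Fin n => X i ω) x) atTop
      (fun _ => ℓ x) := by
  have ht : Tendsto (fun n => (k n : ℝ) / (n : ℝ)) atTop (𝓝[>] 0) := by
    refine tendsto_nhdsWithin_iff.mpr ⟨hk_zero, ?_⟩
    filter_upwards [eventually_ge_atTop 1] with n hn
    have h1 : (0 : ℝ) < k n := by exact_mod_cast (hk n hn).1
    have h2 : (0 : ℝ) < n := by exact_mod_cast hn
    exact div_pos h1 h2
  let S : ℕ → Set (Fin d → ℝ) := fun n =>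
    {y | ∃ j, 1 - marginCDF P j (y j) ≤ (k n : ℝ) / n * x j}
  let Sj : Fin d → ℕ → Set (Fin d → ℝ) := fun j n =>
    {y | 1 - marginCDF P j (y j) ≤ (k n : ℝ) / n * x j}
  have hsmall : ∀ᶠ n : ℕ in atTop, ∀ j, (k n : ℝ) / n * x j ≤ 1 :=
    ht.eventually (eventually_all.mpr fun j => eventually_mul_le_one (x j))
  have hjoint := tendstoInMeasure_tail_count hX_meas hX_indep hX_law hk_top (S := S)
    (fun n => measurableSet_joint_tail P _) ((hPℓ x hx).comp ht)
  have hmarg : ∀ j, TendstoInMeasure μ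
      (fun n ω => (1 / (k n : ℝ)) * ∑ i : Fin n, (Sj j n).indicator (1 : (Fin d → ℝ) → ℝ) (X i ω))
      atTop (fun _ => x j) := by
    intro j
    refine tendstoInMeasure_tail_count hX_meas hX_indep hX_law hk_top
      (fun n => measurableSet_margin_tail P j _) ?_
    refine tendsto_const_nhds.congr' ?_
    filter_upwards [hsmall, ht.eventually self_mem_nhdsWithin] with n hn hpos
    have hpos : 0 < (k n : ℝ) / n := hpos
    rw [measureReal_margin_tail hP j (mul_nonneg hpos.le (hx j)) (hn j),
      inv_mul_cancel_left₀ hpos.ne']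
  refine tendstoInMeasure_const_of_abs_sub fun ε hε => ?_
  -- The index `none` carries the joint count, and `some j` the `j`-th marginal count.
  let V : Option (Fin d) → ℕ → Set (Fin d → ℝ) := fun a => a.elim S Sj
  let Z : Option (Fin d) → ℕ → Ω → ℝ := fun a n ω =>
    (1 / (k n : ℝ)) * ∑ i : Fin n, (V a n).indicator (1 : (Fin d → ℝ) → ℝ) (X i ω)
  have hZ : ∀ a, TendstoInMeasure μ (Z a) atTop (fun _ => a.elim (ℓ x) x) := by
    rintro (_ | j)
    · exact hjoint
    · exact hmarg j
  refine tendsto_measure_abs_sub_of_le_sum hZ (half_lt_self hε) ?_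
  have hd : ∀ᶠ n in atTop, (d : ℝ) / k n ≤ ε / 2 :=
    ((tendsto_const_nhds.div_atTop
      (tendsto_natCast_atTop_atTop.comp hk_top))).eventually (ge_mem_nhds (half_pos hε))
  filter_upwards [hd, hsmall, eventually_ge_atTop 1] with n hdn hsn hn
  filter_upwards [ae_injective_coord hP hX_meas hX_indep hX_law] with ω hω
  have hn0 : (0 : ℝ) < n := by exact_mod_cast hn
  have h := abs_empSTDF_sub_card_le (X := fun i : Fin n => X i ω) (hk n hn).1 (marginCDF P)
    (monotone_marginCDF P) (fun j i i' h => Fin.ext (hω j h)) hx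
    (fun j => by
      have := hsn j
      rwa [div_mul_eq_mul_div, div_le_one hn0] at this) (fun j => (k n : ℝ) / n * x j)
  have hS : ∑ i : Fin n, (S n).indicator (1 : (Fin d → ℝ) → ℝ) (X i ω) = _ :=
    sum_indicator_one_eq_card (fun y => ∃ j, 1 - marginCDF P j (y j) ≤ (k n : ℝ) / n * x j)
      fun i : Fin n => X i ω
  have hSj : ∀ j, ∑ i : Fin n, (Sj j n).indicator (1 : (Fin d → ℝ) → ℝ) (X i ω) = _ := fun j =>
    sum_indicator_one_eq_card (fun y => 1 - marginCDF P j (y j) ≤ (k n : ℝ) / n * x j)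
      fun i : Fin n => X i ω
  simp only [Fintype.sum_option, Z, V, Option.elim_none, Option.elim_some, hS, hSj]
  have htri := abs_sub_le (empSTDF (k n) (fun i : Fin n => X i ω) x)
    (1 / (k n : ℝ) * (Finset.univ.filter fun i : Fin n =>
      ∃ j, 1 - marginCDF P j (X i ω j) ≤ (k n : ℝ) / n * x j).card) (ℓ x)
  linarith

/-- Monotonicity traps `g z` between its values at grid points below and above `z`, and moving `h`
to either of them costs at most `1 / N` per coordinate. -/
theorem abs_sub_le_of_abs_sub_le_on_grid {N : ℕ} (hN : 0 < N) {g h : ℝ × ℝ → ℝ}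
    (hg : ∀ z w, z.1 ≤ w.1 → z.2 ≤ w.2 → g z ≤ g w)
    (hh : ∀ z ∈ unitSquare, ∀ w ∈ unitSquare, h z ≤ h w + (|z.1 - w.1| + |z.2 - w.2|)) {C : ℝ}
    (hC : ∀ a b : Fin (N + 1), |g ((a : ℝ) / N, (b : ℝ) / N) - h ((a : ℝ) / N, (b : ℝ) / N)| ≤ C)
    {z : ℝ × ℝ} (hz : z ∈ unitSquare) : |g z - h z| ≤ C + 2 / N := by
  have hN0 : (0 : ℝ) < N := by exact_mod_cast hN
  have hmem : ∀ a : ℕ, a ≤ N → (a : ℝ) / N ∈ Set.Icc (0 : ℝ) 1 := fun a ha =>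
    ⟨by positivity, (div_le_one hN0).mpr (by exact_mod_cast ha)⟩
  have hbracket : ∀ s ∈ Set.Icc (0 : ℝ) 1, ∃ a b : Fin (N + 1), (a : ℝ) / N ≤ s ∧ s ≤ (b : ℝ) / N ∧
      |(a : ℝ) / N - s| ≤ 1 / N ∧ |(b : ℝ) / N - s| ≤ 1 / N := by
    rintro s ⟨hs0, hs1⟩
    have hsN : s * N ≤ N := by nlinarith
    have hsN0 : 0 ≤ s * N := by positivity
    have hc : ⌈s * N⌉₊ ≤ N := Nat.ceil_le.mpr hsN
    have hf : ⌊s * N⌋₊ ≤ N := (Nat.floor_le_ceil _).trans hc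
    have h1 := Nat.floor_le hsN0
    have h2 := Nat.lt_floor_add_one (s * N)
    have h3 := Nat.le_ceil (s * N)
    have h4 := Nat.ceil_lt_add_one hsN0
    have e1 : (⌊s * N⌋₊ : ℝ) / N ≤ s := (div_le_iff₀ hN0).mpr h1
    have e2 : s ≤ (⌈s * N⌉₊ : ℝ) / N := (le_div_iff₀ hN0).mpr h3
    refine ⟨⟨⌊s * N⌋₊, by omega⟩, ⟨⌈s * N⌉₊, by omega⟩, e1, e2, ?_, ?_⟩
    · rw [abs_of_nonpos (sub_nonpos.mpr e1), neg_sub, sub_le_iff_le_add, ← add_div,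
        le_div_iff₀ hN0]
      linarith
    · rw [abs_of_nonneg (sub_nonneg.mpr e2), sub_le_iff_le_add, div_le_iff₀ hN0, add_mul,
        one_div_mul_cancel hN0.ne']
      linarith
  obtain ⟨a, b, ha, hb, ha', hb'⟩ := hbracket z.1 hz.1
  obtain ⟨a₂, b₂, ha₂, hb₂, ha₂', hb₂'⟩ := hbracket z.2 hz.2
  have mem : ∀ a b : Fin (N + 1), ((a : ℝ) / N, (b : ℝ) / N) ∈ unitSquare := fun a b =>
    ⟨hmem a (Nat.le_of_lt_succ a.2), hmem b (Nat.le_of_lt_succ b.2)⟩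
  have htwo : (2 : ℝ) / N = 1 / N + 1 / N := by ring
  rw [abs_le, htwo]
  constructor
  · have h1 := hg ((a : ℝ) / N, (a₂ : ℝ) / N) z ha ha₂
    have h2 := (abs_le.mp (hC a a₂)).1
    have h3 := hh z hz _ (mem a a₂)
    simp only [abs_sub_comm z.1, abs_sub_comm z.2] at h3
    linarith
  · have h1 := hg z ((b : ℝ) / N, (b₂ : ℝ) / N) hb hb₂
    have h2 := (abs_le.mp (hC b b₂)).2
    have h3 := hh _ (mem b b₂) z hz
    simp only at h3
    linarith

theorem tendstoInMeasure_integral_empSTDF (hP : HasContinuousMargins P) {ℓ : (Fin d → ℝ) → ℝ}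
    (hPℓ : HasSTDF P ℓ) (hX_meas : ∀ i, Measurable (X i))
    (hX_indep : iIndepFun X μ) (hX_law : ∀ i, μ.map (X i) = P) {k : ℕ → ℕ}
    (hk : ∀ n, 1 ≤ n → 1 ≤ k n ∧ k n ≤ n)
    (hk_top : Tendsto k atTop atTop)
    (hk_zero : Tendsto (fun n => (k n : ℝ) / (n : ℝ)) atTop (𝓝 0)) (uv : Fin d × Fin d) :
    TendstoInMeasure μ
      (fun n ω => ∫ z in unitSquare, pairMargin (empSTDF (k n) (fun i : Fin n => X i ω)) uv z)
      atTop (fun _ => ∫ z in unitSquare, pairMargin ℓ uv z) := by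
  refine tendstoInMeasure_const_of_abs_sub fun ε hε => ?_
  -- The mesh is chosen so that the discretization error `2 / N` is below `ε`; the grid is then
  -- fixed as `n` grows.
  obtain ⟨N, hN⟩ := exists_nat_gt (2 / ε)
  have hN0 : (0 : ℝ) < N := (by positivity : 0 < 2 / ε).trans hN
  have hNε : 2 / (N : ℝ) < ε := by
    rw [div_lt_iff₀ hN0]
    rwa [div_lt_iff₀ hε, mul_comm] at hN
  let pt : Fin (N + 1) × Fin (N + 1) → ℝ × ℝ := fun a => ((a.1 : ℝ) / N, (a.2 : ℝ) / N)
  have hpt : ∀ a, pt a ∈ unitSquare := fun a =>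
    ⟨⟨by positivity, (div_le_one hN0).mpr (by exact_mod_cast Nat.le_of_lt_succ a.1.2)⟩,
      ⟨by positivity, (div_le_one hN0).mpr (by exact_mod_cast Nat.le_of_lt_succ a.2.2)⟩⟩
  refine tendsto_measure_abs_sub_of_le_sum
    (fun a => tendstoInMeasure_empSTDF hP hPℓ hX_meas hX_indep hX_law hk hk_top hk_zero
      (pairMargin_arg_nonneg uv (hpt a))) hNε ?_
  refine Eventually.of_forall fun n => Eventually.of_forall fun ω => ?_
  set e := empSTDF (k n) (fun i : Fin n => X i ω)
  rw [← integral_sub (integrableOn_pairMargin_empSTDF _ _ uv)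
    (IsSTDF.integrableOn_pairMargin ⟨P, inferInstance, hP, hPℓ⟩ uv)]
  refine (norm_setIntegral_le_of_norm_le_const
    (f := fun z => pairMargin e uv z - pairMargin ℓ uv z)
    (by rw [volume_unitSquare]; exact ENNReal.one_lt_top)
    (C := ∑ a, |pairMargin e uv (pt a) - pairMargin ℓ uv (pt a)| + 2 / N) fun z hz => ?_).trans_eq ?_
  · rw [Real.norm_eq_abs]
    refine abs_sub_le_of_abs_sub_le_on_grid (g := pairMargin e uv) (h := pairMargin ℓ uv)
      (Nat.cast_pos.mp hN0) (fun z w h1 h2 => ?_)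
      (fun z hz w hw => hPℓ.pairMargin_le hP uv hz hw) (fun a b => ?_) hz
    · exact empSTDF_mono _ _ (add_le_add (Pi.single_mono _ h1) (Pi.single_mono _ h2))
    · change |pairMargin e uv (pt (a, b)) - pairMargin ℓ uv (pt (a, b))| ≤ _
      exact Finset.single_le_sum
        (f := fun a => |pairMargin e uv (pt a) - pairMargin ℓ uv (pt a)|)
        (fun a _ => abs_nonneg _) (Finset.mem_univ (a, b))
  · rw [Measure.real, volume_unitSquare, ENNReal.toReal_one, mul_one]
    rfl

end EmpiricalConvergence

/-! ### Deterministic weighted least squares near an immersed point -/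

section Minimization

variable {E F : Type*} [NormedAddCommGroup E] [NormedSpace ℝ E] [FiniteDimensional ℝ E]
  [NormedAddCommGroup F] [NormedSpace ℝ F]

/-- Near a point where a `C²` map is an immersion, it is bi-Lipschitz from below and its first order
Taylor remainder is uniformly quadratic. -/
theorem exists_ball_quadratic_remainder {U : Set E} {ψ : E → F} {θ₀ : E} (hU : IsOpen U)
    (hθ₀ : θ₀ ∈ U) (hψ : ContDiffOn ℝ 2 ψ U) (hinj : Function.Injective (fderiv ℝ ψ θ₀)) :
    ∃ ρ > 0, ∃ κ > 0, ∃ K > 0, Metric.ball θ₀ ρ ⊆ U ∧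
      ∀ x ∈ Metric.ball θ₀ ρ, ∀ y ∈ Metric.ball θ₀ ρ, κ * ‖y - x‖ ≤ ‖ψ y - ψ x‖ ∧
        ‖ψ y - ψ x - fderiv ℝ ψ x (y - x)‖ ≤ K * ‖y - x‖ ^ 2 := by
  have hψ₀ : ContDiffAt ℝ 2 ψ θ₀ := hψ.contDiffAt (hU.mem_nhds hθ₀)
  obtain ⟨K, s, hs, hK⟩ :=
    (hψ₀.fderiv_right (m := 1) (by norm_num)).exists_lipschitzOnWith
  obtain ⟨A, hA, hAl⟩ := LinearMap.exists_antilipschitzWith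
    (fderiv ℝ ψ θ₀ : E →ₗ[ℝ] F) (LinearMap.ker_eq_bot.mpr hinj)
  have hA' : (0 : NNReal) < A⁻¹ / 2 := by positivity
  -- The derivative at `θ₀` expands norms by at least `A⁻¹`. An approximation error of half that
  -- rate leaves the lower constant `A⁻¹ / 2`.
  obtain ⟨t, ht, htA⟩ := (hψ₀.hasStrictFDerivAt (by norm_num)).approximates_deriv_on_nhds
    (c := A⁻¹ / 2) (Or.inr hA')
  obtain ⟨ρ, hρ, hball⟩ := Metric.mem_nhds_iff.mp
    (inter_mem (inter_mem hs ht) (hU.mem_nhds hθ₀))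
  refine ⟨ρ, hρ, (A : ℝ)⁻¹ / 2, by positivity, K + 1, by positivity,
    fun x hx => (hball hx).2, fun x hx y hy => ⟨?_, ?_⟩⟩
  · have h1 := htA y (hball hy).1.2 x (hball hx).1.2
    have h2 := hAl.le_mul_dist y x
    rw [dist_eq_norm, dist_eq_norm, ← map_sub] at h2
    have h3 : (A : ℝ)⁻¹ * ‖y - x‖ ≤ ‖fderiv ℝ ψ θ₀ (y - x)‖ := by
      rw [inv_mul_le_iff₀ (by exact_mod_cast hA)]
      exact h2
    have h4 := norm_sub_norm_le (fderiv ℝ ψ θ₀ (y - x)) (ψ y - ψ x)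
    rw [norm_sub_rev _ (ψ y - ψ x)] at h4
    push_cast at h1
    linarith
  · have hseg : segment ℝ x y ⊆ Metric.ball θ₀ ρ := (convex_ball θ₀ ρ).segment_subset hx hy
    -- Mean value inequality on the segment: the derivative varies there by at most a Lipschitz
    -- constant times `‖y - x‖`. Using `K + 1` keeps the constant positive.
    have := Convex.norm_image_sub_le_of_norm_hasFDerivWithin_le' (f := ψ) (f' := fderiv ℝ ψ)
      (φ := fderiv ℝ ψ x) (C := (K + 1) * ‖y - x‖) (s := segment ℝ x y) (x := x) (y := y)
      (fun z hz => ((hψ.differentiableOn (by norm_num)).differentiableAt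
        (hU.mem_nhds (hball (hseg hz)).2)).hasFDerivAt.hasFDerivWithinAt)
      (fun z hz => by
        have h1 := hK.dist_le_mul z (hball (hseg hz)).1.1 x (hball hx).1.1
        rw [dist_eq_norm, dist_eq_norm] at h1
        have h2 : ‖z - x‖ ≤ ‖y - x‖ := norm_sub_le_of_mem_segment hz
        refine h1.trans ?_
        gcongr
        linarith)
      (convex_segment x y) (left_mem_segment ℝ x y) (right_mem_segment ℝ x y)
    linarith

/-- For targets near `ψ θ₀`, the weighted least squares problem `B (T - ψ θ) (T - ψ θ) → min` over
`Θ` has exactly one solution, and it is near `θ₀`, uniformly over weights with given bounds. -/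
theorem exists_forall_existsUnique_leastSquares {Θ U : Set E} {ψ : E → F} {θ₀ : E}
    (hemb : IsEmbedding fun θ : Θ => ψ θ) (hU : IsOpen U) (hθ₀ : θ₀ ∈ U) (hUΘ : U ⊆ Θ)
    (hψ : ContDiffOn ℝ 2 ψ U) (hinj : Function.Injective (fderiv ℝ ψ θ₀)) {c C r : ℝ}
    (hc : 0 < c) (hC : 0 < C) (hr : 0 < r) :
    ∃ η > 0, ∀ T : F, ‖T - ψ θ₀‖ ≤ η → ∀ B : F →L[ℝ] F →L[ℝ] ℝ, (∀ u v, B u v = B v u) →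
      (∀ v, c * ‖v‖ ^ 2 ≤ B v v) → ‖B‖ ≤ C →
      ∃ θ ∈ Metric.ball θ₀ r,
        (θ ∈ Θ ∧ ∀ θ' ∈ Θ, B (T - ψ θ) (T - ψ θ) ≤ B (T - ψ θ') (T - ψ θ')) ∧
        ∀ θ₁, (θ₁ ∈ Θ ∧ ∀ θ' ∈ Θ, B (T - ψ θ₁) (T - ψ θ₁) ≤ B (T - ψ θ') (T - ψ θ')) →
          θ₁ = θ := by
  obtain ⟨ρ, hρ, κ, hκ, K, hK, hρU, hloc⟩ := exists_ball_quadratic_remainder hU hθ₀ hψ hinj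
  obtain ⟨R, hR, hRr, hRρ⟩ : ∃ R > 0, R < r ∧ R < ρ :=
    ⟨min r ρ / 2, by positivity, (half_lt_self (by positivity)).trans_le (min_le_left _ _),
      (half_lt_self (by positivity)).trans_le (min_le_right _ _)⟩
  -- Continuity of the inverse of `ψ` at `ψ θ₀` excludes distant parameters with nearly the same
  -- image.
  obtain ⟨δ, hδ, hδR⟩ : ∃ δ > 0, ∀ θ ∈ Θ, ‖ψ θ - ψ θ₀‖ < δ → θ ∈ Metric.ball θ₀ R := by
    have hmem : {θ : Θ | (θ : E) ∈ Metric.ball θ₀ R} ∈ 𝓝 (⟨θ₀, hUΘ hθ₀⟩ : Θ) :=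
      continuous_subtype_val.continuousAt (Metric.ball_mem_nhds θ₀ hR)
    rw [hemb.isInducing.nhds_eq_comap, mem_comap] at hmem
    obtain ⟨V, hV, hVsub⟩ := hmem
    obtain ⟨δ, hδ, hδV⟩ := Metric.mem_nhds_iff.mp hV
    refine ⟨δ, hδ, fun θ hθ h => hVsub (a := ⟨θ, hθ⟩) (hδV ?_)⟩
    rwa [Metric.mem_ball, dist_eq_norm]
  -- `m` will bound the residual at the minimizer. The first bound localizes, and the second makes
  -- the curvature term lose to the quadratic growth.
  obtain ⟨m, hm, hmδ, hmK⟩ : ∃ m > 0, m ≤ δ / 2 ∧ 2 * C * K * m < c * κ ^ 2 := by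
    refine ⟨min (δ / 2) (c * κ ^ 2 / (4 * C * K)), by positivity, min_le_left _ _, ?_⟩
    calc 2 * C * K * min (δ / 2) (c * κ ^ 2 / (4 * C * K))
        ≤ 2 * C * K * (c * κ ^ 2 / (4 * C * K)) := by gcongr; exact min_le_right _ _
      _ = c * κ ^ 2 / 2 := by field_simp; norm_num
      _ < c * κ ^ 2 := half_lt_self (by positivity)
  obtain ⟨σ, hσ, hσc⟩ : ∃ σ > 0, C * σ ^ 2 < c := by
    refine ⟨min 1 (c / (2 * C)), by positivity, ?_⟩
    have h1 : min 1 (c / (2 * C)) ≤ 1 := min_le_left _ _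
    have h0 : 0 < min 1 (c / (2 * C)) := by positivity
    calc C * min 1 (c / (2 * C)) ^ 2 ≤ C * min 1 (c / (2 * C)) := by gcongr; nlinarith
      _ ≤ C * (c / (2 * C)) := by gcongr; exact min_le_right _ _
      _ = c / 2 := by field_simp
      _ < c := half_lt_self hc
  refine ⟨min (δ / 3) (σ * m), by positivity, fun T hT B hsymm hcoer hB => ?_⟩
  have hT1 : ‖T - ψ θ₀‖ ≤ δ / 3 := hT.trans (min_le_left _ _)
  have hT2 : ‖T - ψ θ₀‖ ≤ σ * m := hT.trans (min_le_right _ _)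
  have hBle : ∀ u v, |B u v| ≤ C * ‖u‖ * ‖v‖ := fun u v =>
    (B.le_opNorm₂ u v).trans (by gcongr)
  let f : E → ℝ := fun θ => B (T - ψ θ) (T - ψ θ)
  -- Coercivity and boundedness give `c * ‖T - ψ θ‖ ^ 2 ≤ f θ ≤ f θ₀ ≤ C * (σ * m) ^ 2 < c * m ^ 2`.
  have hsub : ∀ θ, f θ ≤ f θ₀ → ‖T - ψ θ‖ < m := by
    intro θ hθ
    have h1 : f θ₀ ≤ C * (σ * m) ^ 2 := by
      refine (le_abs_self _).trans ((hBle _ _).trans ?_)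
      rw [mul_assoc, ← sq]
      gcongr
    have h2 : c * ‖T - ψ θ‖ ^ 2 < c * m ^ 2 := by
      have := hcoer (T - ψ θ)
      have h3 : C * (σ * m) ^ 2 < c * m ^ 2 := by
        rw [mul_pow, ← mul_assoc]
        gcongr
      linarith
    exact lt_of_pow_lt_pow_left₀ 2 hm.le (lt_of_mul_lt_mul_left h2 hc.le)
  have hsubR : ∀ θ ∈ Θ, f θ ≤ f θ₀ → θ ∈ Metric.ball θ₀ R := by
    intro θ hθΘ hθ
    refine hδR θ hθΘ ?_
    have h1 := norm_sub_le_norm_sub_add_norm_sub (ψ θ) T (ψ θ₀)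
    rw [norm_sub_rev (ψ θ) T] at h1
    linarith [hsub θ hθ]
  have hRρ' : Metric.closedBall θ₀ R ⊆ Metric.ball θ₀ ρ := Metric.closedBall_subset_ball hRρ
  have hfcont : ContinuousOn f (Metric.closedBall θ₀ R) := by
    have h1 : ContinuousOn (fun θ => T - ψ θ) (Metric.closedBall θ₀ R) :=
      continuousOn_const.sub (hψ.continuousOn.mono (hRρ'.trans hρU))
    exact (B.continuous.comp_continuousOn h1).clm_apply h1
  have : ProperSpace E := FiniteDimensional.proper ℝ E
  obtain ⟨θ, hθR, hθmin⟩ := (isCompact_closedBall θ₀ R).exists_isMinOn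
    ⟨θ₀, Metric.mem_closedBall_self hR.le⟩ hfcont
  have hθΘ : θ ∈ Θ := hUΘ (hρU (hRρ' hθR))
  have hθθ₀ : f θ ≤ f θ₀ := hθmin (Metric.mem_closedBall_self hR.le)
  have hθball := hsubR θ hθΘ hθθ₀
  -- A competitor no worse than `θ₀` lies in the ball, and any other already loses to `θ₀`.
  have hmin : ∀ θ' ∈ Θ, f θ ≤ f θ' := by
    intro θ' hθ'
    rcases le_total (f θ') (f θ₀) with h | h
    · exact hθmin (Metric.ball_subset_closedBall (hsubR θ' hθ' h))
    · exact hθθ₀.trans h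
  refine ⟨θ, Metric.ball_subset_ball hRr.le hθball, ⟨hθΘ, hmin⟩, fun θ₁ ⟨hθ₁Θ, hθ₁min⟩ => ?_⟩
  have hθ₁ball := hsubR θ₁ hθ₁Θ (hθ₁min θ₀ (hUΘ hθ₀))
  -- First-order condition: the minimizer is interior to the ball, so the residual is `B`-orthogonal
  -- to the range of the derivative.
  have hfoc : ∀ h, B (T - ψ θ) (fderiv ℝ ψ θ h) = 0 := by
    intro h
    have hlm : IsLocalMin f θ :=
      hθmin.isLocalMin (Metric.closedBall_mem_nhds_of_mem hθball)
    have hd : HasFDerivAt (fun θ => T - ψ θ) (-fderiv ℝ ψ θ) θ :=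
      ((hψ.differentiableOn (by norm_num)).differentiableAt
        (hU.mem_nhds (hρU (hRρ' hθR)))).hasFDerivAt.const_sub T
    have h0 := hlm.hasFDerivAt_eq_zero (B.hasFDerivAt_of_bilinear hd hd)
    have h1 : B (T - ψ θ) (-fderiv ℝ ψ θ h) + B (-fderiv ℝ ψ θ h) (T - ψ θ) = 0 :=
      DFunLike.congr_fun h0 h
    rw [hsymm (-fderiv ℝ ψ θ h), map_neg] at h1
    linarith
  obtain ⟨hlow, hrem⟩ := hloc θ (hRρ' hθR) θ₁ (hRρ' (Metric.ball_subset_closedBall hθ₁ball))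
  set D := ψ θ₁ - ψ θ
  set Q := D - fderiv ℝ ψ θ (θ₁ - θ)
  have hBD : B (T - ψ θ) D = B (T - ψ θ) Q := by
    rw [show B (T - ψ θ) Q = B (T - ψ θ) D - B (T - ψ θ) (fderiv ℝ ψ θ (θ₁ - θ)) from map_sub _ _ _,
      hfoc, sub_zero]
  have hexp : f θ₁ = f θ - 2 * B (T - ψ θ) D + B D D := by
    have hsq : ∀ e D, B (e - D) (e - D) = B e e - 2 * B e D + B D D := fun e D => by
      simp only [map_sub, sub_apply, hsymm D e]
      ring
    rw [← hsq, show T - ψ θ - D = T - ψ θ₁ by simp only [D]; abel]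
  have h1 : B (T - ψ θ) Q ≤ C * m * (K * ‖θ₁ - θ‖ ^ 2) := by
    refine (le_abs_self _).trans ((hBle _ _).trans ?_)
    gcongr
    exact (hsub θ hθθ₀).le
  have h2 : c * (κ * ‖θ₁ - θ‖) ^ 2 ≤ B D D := (by gcongr : _ ≤ c * ‖D‖ ^ 2).trans (hcoer D)
  have h3 : f θ₁ ≤ f θ := hθ₁min θ hθΘ
  -- By orthogonality only the Taylor remainder `Q` survives in the cross term, so that term is also
  -- quadratic in `‖θ₁ - θ‖`, with a smaller coefficient than `B D D`.
  have h4 : (c * κ ^ 2 - 2 * C * K * m) * ‖θ₁ - θ‖ ^ 2 ≤ 0 := by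
    rw [hBD] at hexp
    nlinarith
  have h5 : ‖θ₁ - θ‖ ^ 2 ≤ 0 := by
    by_contra! h
    exact absurd h4 (not_le.mpr (mul_pos (by linarith) h))
  have h6 : ‖θ₁ - θ‖ = 0 := pow_eq_zero_iff two_ne_zero |>.mp (le_antisymm h5 (sq_nonneg _))
  exact sub_eq_zero.mp (norm_eq_zero.mp h6)

end Minimization

/-! ### Weight matrices as bilinear forms -/

section WeightForm

variable {q : ℕ}

theorem abs_dotProduct_mulVec_le (W : Matrix (Fin q) (Fin q) ℝ) (u v : Fin q → ℝ) :
    |u ⬝ᵥ (W *ᵥ v)| ≤ (∑ i, ∑ j, |W i j|) * ‖u‖ * ‖v‖ := by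
  simp only [dotProduct, Matrix.mulVec, Finset.mul_sum, Finset.sum_mul]
  refine (Finset.abs_sum_le_sum_abs _ _).trans (Finset.sum_le_sum fun i _ =>
    (Finset.abs_sum_le_sum_abs _ _).trans (Finset.sum_le_sum fun j _ => ?_))
  rw [abs_mul, abs_mul]
  calc |u i| * (|W i j| * |v j|) ≤ ‖u‖ * (|W i j| * ‖v‖) := by
        gcongr
        · exact norm_le_pi_norm u i
        · exact norm_le_pi_norm v j
    _ = _ := by ring

/-- The bilinear form `(u, v) ↦ uᵀ W v` as a continuous bilinear map. -/
noncomputable def weightForm (W : Matrix (Fin q) (Fin q) ℝ) :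
    (Fin q → ℝ) →L[ℝ] (Fin q → ℝ) →L[ℝ] ℝ :=
  LinearMap.mkContinuous₂ (Matrix.toBilin' W) (∑ i, ∑ j, |W i j|) fun u v => by
    rw [Matrix.toBilin'_apply', Real.norm_eq_abs]
    exact abs_dotProduct_mulVec_le W u v

theorem weightForm_apply (W : Matrix (Fin q) (Fin q) ℝ) (u v : Fin q → ℝ) :
    weightForm W u v = u ⬝ᵥ (W *ᵥ v) := by
  rw [weightForm, LinearMap.mkContinuous₂_apply, Matrix.toBilin'_apply']

theorem norm_weightForm_le (W : Matrix (Fin q) (Fin q) ℝ) :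
    ‖weightForm W‖ ≤ ∑ i, ∑ j, |W i j| :=
  LinearMap.mkContinuous₂_norm_le _ (by positivity) _

theorem weightForm_comm {W : Matrix (Fin q) (Fin q) ℝ} (hW : W.PosDef) (u v : Fin q → ℝ) :
    weightForm W u v = weightForm W v u := by
  have hsymm : Wᵀ = W := by
    rw [← Matrix.conjTranspose_eq_transpose_of_trivial]
    exact hW.isHermitian
  rw [weightForm_apply, weightForm_apply, Matrix.dotProduct_mulVec, ← Matrix.mulVec_transpose,
    hsymm, dotProduct_comm]

theorem exists_coercive_of_posDef {W : Matrix (Fin q) (Fin q) ℝ} (hW : W.PosDef) :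
    ∃ c > 0, ∀ v, c * ‖v‖ ^ 2 ≤ weightForm W v v := by
  have hpos : ∀ v, v ≠ 0 → 0 < weightForm W v v := fun v hv => by
    rw [weightForm_apply]
    simpa using hW.dotProduct_mulVec_pos hv
  -- The sphere is empty when `q = 0`. Otherwise the coercivity constant is the minimum of the form
  -- on this compact set.
  rcases (Metric.sphere (0 : Fin q → ℝ) 1).eq_empty_or_nonempty with h | h
  · refine ⟨1, one_pos, fun v => ?_⟩
    have hv : v = 0 := by
      by_contra hv
      have : ‖v‖⁻¹ • v ∈ Metric.sphere (0 : Fin q → ℝ) 1 := by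
        rw [mem_sphere_zero_iff_norm, norm_smul, norm_inv, norm_norm,
          inv_mul_cancel₀ (norm_ne_zero_iff.mpr hv)]
      rw [h] at this
      exact this
    simp [hv]
  · obtain ⟨v₀, hv₀, hmin⟩ := (isCompact_sphere (0 : Fin q → ℝ) 1).exists_isMinOn h
      (f := fun v => weightForm W v v)
      (((weightForm W).continuous.clm_apply continuous_id).continuousOn)
    refine ⟨weightForm W v₀ v₀, hpos v₀ (ne_zero_of_mem_unit_sphere ⟨v₀, hv₀⟩), fun v => ?_⟩
    by_cases hv : v = 0
    · simp [hv]
    have hn : ‖v‖ ≠ 0 := norm_ne_zero_iff.mpr hv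
    have hmem : ‖v‖⁻¹ • v ∈ Metric.sphere (0 : Fin q → ℝ) 1 := by
      rw [mem_sphere_zero_iff_norm, norm_smul, norm_inv, norm_norm, inv_mul_cancel₀ hn]
    have hle : weightForm W v₀ v₀ ≤ weightForm W (‖v‖⁻¹ • v) (‖v‖⁻¹ • v) := hmin hmem
    simp only [map_smul, smul_apply, smul_eq_mul] at hle
    calc weightForm W v₀ v₀ * ‖v‖ ^ 2
        ≤ ‖v‖⁻¹ * (‖v‖⁻¹ * weightForm W v v) * ‖v‖ ^ 2 := by gcongr
      _ = weightForm W v v := by field_simp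

/-- An entrywise perturbation of size `γ` changes the quadratic form by at most `q * q * γ * ‖v‖ ^
2`, so a small `γ` spends only half of the coercivity of `W₀`. -/
theorem exists_uniform_bounds_near_posDef {W₀ : Matrix (Fin q) (Fin q) ℝ} (hW₀ : W₀.PosDef) :
    ∃ γ > 0, ∃ c > 0, ∃ C > 0, ∀ W : Matrix (Fin q) (Fin q) ℝ, (∀ i j, |W i j - W₀ i j| ≤ γ) →
      (∀ v, c * ‖v‖ ^ 2 ≤ weightForm W v v) ∧ ‖weightForm W‖ ≤ C := by
  obtain ⟨c, hc, hcoer⟩ := exists_coercive_of_posDef hW₀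
  obtain ⟨γ, hγ, hγc⟩ : ∃ γ : ℝ, 0 < γ ∧ q * (q * γ) ≤ c / 2 := by
    refine ⟨c / 2 / (q * q + 1), by positivity, ?_⟩
    rw [← mul_assoc, mul_div_assoc', div_le_iff₀ (by positivity)]
    nlinarith
  refine ⟨γ, hγ, c / 2, by positivity, ∑ i, ∑ j, |W₀ i j| + c / 2, by positivity, fun W hW => ?_⟩
  have hsum : ∑ i, ∑ j, |(W - W₀) i j| ≤ c / 2 := by
    refine le_trans ?_ hγc
    calc ∑ i, ∑ j, |(W - W₀) i j| ≤ ∑ _i : Fin q, ∑ _j : Fin q, γ :=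
          Finset.sum_le_sum fun i _ => Finset.sum_le_sum fun j _ => hW i j
      _ = q * (q * γ) := by simp
  constructor
  · intro v
    have h1 := (abs_le.mp (abs_dotProduct_mulVec_le (W - W₀) v v)).1
    have h2 : (∑ i, ∑ j, |(W - W₀) i j|) * ‖v‖ * ‖v‖ ≤ c / 2 * ‖v‖ * ‖v‖ := by gcongr
    have h3 := hcoer v
    rw [weightForm_apply] at h3 ⊢
    rw [Matrix.sub_mulVec, dotProduct_sub] at h1
    nlinarith
  · refine (norm_weightForm_le W).trans ?_
    calc ∑ i, ∑ j, |W i j| ≤ ∑ i, ∑ j, (|W₀ i j| + |(W - W₀) i j|) := by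
          gcongr with i _ j
          rw [Matrix.sub_apply]
          simpa using abs_add_le (W₀ i j) (W i j - W₀ i j)
      _ ≤ _ := by
          simp only [Finset.sum_add_distrib]
          gcongr

end WeightForm

/-! ### Reduction to least squares and conclusion -/

theorem objective_eq_weightForm {n p q d : ℕ} {Θ : Set (EuclideanSpace ℝ (Fin p))}
    {ℓ : EuclideanSpace ℝ (Fin p) → (Fin d → ℝ) → ℝ} (hℓ : ∀ θ ∈ Θ, IsSTDF (ℓ θ)) (k : ℕ)
    (X : Fin n → Fin d → ℝ) (π : Fin q → Fin d × Fin d) (W : Matrix (Fin q) (Fin q) ℝ)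
    {θ : EuclideanSpace ℝ (Fin p)} (hθ : θ ∈ Θ) :
    objective k X ℓ π W θ =
      weightForm W ((fun m => ∫ z in unitSquare, pairMargin (empSTDF k X) (π m) z) - psi ℓ π θ)
        ((fun m => ∫ z in unitSquare, pairMargin (empSTDF k X) (π m) z) - psi ℓ π θ) := by
  have : discrepancy k X ℓ π θ =
      (fun m => ∫ z in unitSquare, pairMargin (empSTDF k X) (π m) z) - psi ℓ π θ := by
    ext m
    exact integral_sub (integrableOn_pairMargin_empSTDF k X (π m))
      ((hℓ θ hθ).integrableOn_pairMargin (π m))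
  rw [objective, this, weightForm_apply]

end PairwiseTail

theorem theorem3p1 {p q d : ℕ} (hpq : p ≤ q) (hqd : q ≤ d * (d - 1) / 2)
    -- the parametric family of stable tail dependence functions
    (Θ : Set (EuclideanSpace ℝ (Fin p)))
    (ℓ : EuclideanSpace ℝ (Fin p) → (Fin d → ℝ) → ℝ)
    (hℓ : ∀ θ ∈ Θ, IsSTDF (ℓ θ))
    -- the distinct pairs
    (π : Fin q → Fin d × Fin d) (hπ_lt : ∀ m, (π m).1 < (π m).2)
    (hπ : Function.Injective π)
    -- the map `psi` is a homeomorphism from `Θ` onto its image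
    (hψ : IsEmbedding (fun θ : Θ => psi ℓ π (θ : EuclideanSpace ℝ (Fin p))))
    -- the distribution `P` and the true parameter
    (P : Measure (Fin d → ℝ)) [IsProbabilityMeasure P]
    (hP : HasContinuousMargins P)
    (θ₀ : EuclideanSpace ℝ (Fin p)) (hθ₀ : θ₀ ∈ interior Θ)
    (hPℓ : HasSTDF P (ℓ θ₀))
    -- the iid sample
    {Ω : Type*} [MeasurableSpace Ω] (μ : Measure Ω) [IsProbabilityMeasure μ]
    (X : ℕ → Ω → (Fin d → ℝ)) (hX_meas : ∀ i, Measurable (X i))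
    (hX_indep : iIndepFun X μ) (hX_law : ∀ i, μ.map (X i) = P)
    -- the intermediate sequence
    (k : ℕ → ℕ) (hk : ∀ n, 1 ≤ n → 1 ≤ k n ∧ k n ≤ n)
    (hk_top : Tendsto k atTop atTop)
    (hk_zero : Tendsto (fun n => (k n : ℝ) / (n : ℝ)) atTop (𝓝 0))
    -- the random weight matrices
    (W : ℕ → Ω → Matrix (Fin q) (Fin q) ℝ)
    (hW_meas : ∀ n i j, Measurable (fun ω => W n ω i j))
    (hW_pos : ∀ n, ∀ᵐ ω ∂μ, (W n ω).PosDef)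
    -- smoothness and full rank
    (hψ_smooth : ∃ U : Set (EuclideanSpace ℝ (Fin p)),
      IsOpen U ∧ θ₀ ∈ U ∧ U ⊆ Θ ∧ ContDiffOn ℝ 2 (psi ℓ π) U)
    (hψ_rank : Module.finrank ℝ
      (LinearMap.range (fderiv ℝ (psi ℓ π) θ₀ : EuclideanSpace ℝ (Fin p) →ₗ[ℝ] (Fin q → ℝ))) = p)
    -- convergence of the weight matrices
    (W₀ : Matrix (Fin q) (Fin q) ℝ) (hW₀ : W₀.PosDef)
    (hW_conv : ∀ i j,
      TendstoInMeasure μ (fun n ω => W n ω i j) atTop (fun _ => W₀ i j)) :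
    -- existence and uniqueness of the minimizer with probability tending to one
    WithProbTendingToOne μ (fun n => {ω |
      ∃! θ, θ ∈ minimizers Θ (k n) (fun i : Fin n => X i ω) ℓ π (W n ω)}) ∧
    -- consistency, the estimator being arbitrary where there is no unique minimizer
    (∀ θhat : ℕ → Ω → EuclideanSpace ℝ (Fin p),
      (∀ n ω, (∃! θ, θ ∈ minimizers Θ (k n) (fun i : Fin n => X i ω) ℓ π (W n ω)) →
        θhat n ω ∈ minimizers Θ (k n) (fun i : Fin n => X i ω) ℓ π (W n ω)) →
      TendstoInMeasure μ θhat atTop (fun _ => θ₀)) := by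
  obtain ⟨U, hU, hθ₀U, hUΘ, hψU⟩ := hψ_smooth
  have hinj : Function.Injective (fderiv ℝ (psi ℓ π) θ₀) := by
    have h := LinearMap.finrank_range_add_finrank_ker
      (fderiv ℝ (psi ℓ π) θ₀ : EuclideanSpace ℝ (Fin p) →ₗ[ℝ] (Fin q → ℝ))
    rw [hψ_rank, finrank_euclideanSpace_fin, Nat.add_eq_left, Submodule.finrank_eq_zero] at h
    exact LinearMap.ker_eq_bot.mp h
  obtain ⟨γ, hγ, c, hc, C, hC, hbounds⟩ := exists_uniform_bounds_near_posDef hW₀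
  let M : ℕ → Ω → Set (EuclideanSpace ℝ (Fin p)) := fun n ω =>
    minimizers Θ (k n) (fun i : Fin n => X i ω) ℓ π (W n ω)
  let T : ℕ → Ω → Fin q → ℝ := fun n ω m =>
    ∫ z in unitSquare, pairMargin (empSTDF (k n) (fun i : Fin n => X i ω)) (π m) z
  have hT : ∀ m, TendstoInMeasure μ (fun n ω => T n ω m) atTop (fun _ => psi ℓ π θ₀ m) := fun m =>
    tendstoInMeasure_integral_empSTDF hP hPℓ hX_meas hX_indep hX_law hk hk_top hk_zero (π m)
  -- A single event yields both conclusions: any fixed `r` gives existence and uniqueness, and `r =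
  -- ε` gives consistency.
  have key : ∀ r > 0, Tendsto
      (fun n => μ {ω | ∃ θ ∈ Metric.ball θ₀ r, θ ∈ M n ω ∧ ∀ θ₁ ∈ M n ω, θ₁ = θ}ᶜ)
      atTop (𝓝 0) := by
    intro r hr
    obtain ⟨η, hη, hLS⟩ :=
      exists_forall_existsUnique_leastSquares hψ hU hθ₀U hUΘ hψU hinj hc hC hr
    have hlim : Tendsto (fun n => ∑ m, μ {ω | η ≤ |T n ω m - psi ℓ π θ₀ m|} +
        ∑ a : Fin q × Fin q, μ {ω | γ ≤ |W n ω a.1 a.2 - W₀ a.1 a.2|}) atTop (𝓝 0) := by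
      have h1 := tendsto_finsetSum Finset.univ fun m _ =>
        tendstoInMeasure_iff_norm.mp (hT m) η hη
      have h2 := tendsto_finsetSum Finset.univ fun (a : Fin q × Fin q) _ =>
        tendstoInMeasure_iff_norm.mp (hW_conv a.1 a.2) γ hγ
      simpa using h1.add h2
    refine tendsto_of_tendsto_of_tendsto_of_le_of_le tendsto_const_nhds hlim
      (fun _ => zero_le) fun n => ?_
    -- Outside these finitely many deviation events, and almost surely, the deterministic result
    -- applies. Monotonicity of outer measure avoids any measurability question for the set of
    -- minimizers.
    calc _ ≤ μ ((⋃ m, {ω | η ≤ |T n ω m - psi ℓ π θ₀ m|}) ∪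
          ⋃ a : Fin q × Fin q, {ω | γ ≤ |W n ω a.1 a.2 - W₀ a.1 a.2|}) := by
          refine measure_mono_ae ?_
          filter_upwards [hW_pos n] with ω hω hbad
          by_contra hcon
          have h1 : ∀ m, |T n ω m - psi ℓ π θ₀ m| ≤ η := fun m => by
            by_contra h
            exact hcon (Or.inl (Set.mem_iUnion.mpr ⟨m, (not_le.mp h).le⟩))
          have h2 : ∀ i j, |W n ω i j - W₀ i j| ≤ γ := fun i j => by
            by_contra h
            exact hcon (Or.inr (Set.mem_iUnion.mpr ⟨(i, j), (not_le.mp h).le⟩))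
          have h3 : ‖T n ω - psi ℓ π θ₀‖ ≤ η := (pi_norm_le_iff_of_nonneg hη.le).mpr h1
          obtain ⟨hcoer, hnorm⟩ := hbounds (W n ω) h2
          obtain ⟨θ, hθr, hθmin, hθuniq⟩ := hLS (T n ω) h3 (weightForm (W n ω))
            (weightForm_comm hω) hcoer hnorm
          have hM : ∀ θ, θ ∈ M n ω ↔ θ ∈ Θ ∧ ∀ θ' ∈ Θ,
              weightForm (W n ω) (T n ω - psi ℓ π θ) (T n ω - psi ℓ π θ) ≤
                weightForm (W n ω) (T n ω - psi ℓ π θ') (T n ω - psi ℓ π θ') := fun θ =>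
            and_congr_right fun hθ => forall₂_congr fun θ' hθ' => by
              rw [objective_eq_weightForm hℓ _ _ _ _ hθ, objective_eq_weightForm hℓ _ _ _ _ hθ']
          exact hbad ⟨θ, hθr, (hM θ).mpr hθmin, fun θ₁ hθ₁ => hθuniq θ₁ ((hM θ₁).mp hθ₁)⟩
      _ ≤ _ := (measure_union_le _ _).trans
          (add_le_add (measure_iUnion_fintype_le _ _) (measure_iUnion_fintype_le _ _))
  constructor
  · refine tendsto_of_tendsto_of_tendsto_of_le_of_le tendsto_const_nhds (key 1 one_pos)
      (fun _ => zero_le) fun n => measure_mono (Set.compl_subset_compl.mpr ?_)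
    rintro ω ⟨θ, -, hθ, huniq⟩
    exact ⟨θ, hθ, huniq⟩
  · intro θhat hθhat
    refine tendstoInMeasure_iff_dist.mpr fun ε hε => ?_
    refine tendsto_of_tendsto_of_tendsto_of_le_of_le tendsto_const_nhds (key ε hε)
      (fun _ => zero_le) fun n => measure_mono ?_
    -- On the good event the minimizer is unique, so the arbitrary values of the estimator play no
    -- role.
    rintro ω hω ⟨θ, hθε, hθ, huniq⟩
    have h := huniq _ (hθhat n ω ⟨θ, hθ, huniq⟩)
    have hω : ε ≤ dist (θhat n ω) θ₀ := hω
    rw [h] at hω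
    exact absurd hθε (not_lt.mpr hω)
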